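/- **Setting.** Fix $k\ge 1$, positive constants $\lambda^{(i)}_1,\dots,\lambda^{(i)}_k$ ($i=1,2$), and $\alpha,\beta\in(0,1)$; put $\Lambda^{(i)}=\sum_{j=1}^k\lambda^{(i)}_j$. A generalized Poisson random field on $\mathbb{R}_+^2$ with rates $(\lambda_j)_{1\le j\le k}$, written $GPRF\{\lambda_j\}$, is an $\mathbb{N}_0$-valued process $M(s,t)=M([0,s]\times[0,t])$ obtained from a random measure, with $M(0,t)=M(s,0)=0$ almost surely, with independent increments over disjoint rectangles, and such that for $s<s'$, $t<t'$ the increment over $(s,s']\times(t,t']$, an area $a=(s'-s)(t'-t)$, takes the value $n\ge 0$ with probability $$\sum_{\substack{n_1,\dots,n_k\ge 0\\ n_1+2n_2+\dots+kn_k=n}}\ \prod_{j=1}^k\frac{(\lambda_j a)^{n_j}}{n_j!}e^{-\lambda_j a}.$$ Let $M_1\sim GPRF\{\lambda^{(1)}_j\}$ and $M_2\sim GPRF\{\lambda^{(2)}_j\}$ be independent, and let $\mathcal S=M_1-M_2$. For $\alpha\in(0,1)$ the inverse stable subordinator of index $\alpha$ is $L^\alpha(t)=\inf\{x\ge 0: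 H^\alpha(x)\ge t\}$, where $H^\alpha$ is a non-decreasing Lévy process with $\mathbb{E}e^{-uH^\alpha(t)}=e^{-tu^\alpha}$, $u>0$. Let $L^\alpha$ and $L^\beta$ be inverse stable subordinators of indices $\alpha$ and $\beta$ such that $\mathcal S,L^\alpha,L^\beta$ are mutually independent, and put $\mathcal S^{\alpha,\beta}(s,t)=\mathcal S(L^\alpha(s),L^\beta(t))$. The generalized Wright function is $${}_2\Psi_2\left[\begin{matrix}(a_1,\alpha_1),&(a_2,\alpha_2)\\(b_1,\beta_1),&(b_2,\beta_2)\end{matrix}\,\middle|\,x\right]=\sum_{r=0}^\infty\frac{\Gamma(\alpha_1r+a_1)\Gamma(\alpha_2r+a_2)}{\Gamma(\beta_1r+b_1)\Gamma(\beta_2r+b_2)\,r!}\,x^r .$$ **Theorem.** Let $s,t\ge 0$ be such that the Wright series below converge absolutely, that is, assume that one of the following holds: $\alpha+\beta>1$; or $\alpha+\beta=1$ and $(\Lambda^{(1)}+\Lambda^{(2)})s^\alpha t^\beta<\alpha^\alpha\beta^\beta$; or $st=0$. Then for every $n\in\mathbb{Z}$ $$\Pr\{\mathcal S^{\alpha,\beta}(s,t)=n\}=\sum_{\substack{(n_1,\dots,n_k)\in\mathbb{Z}^k\\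 n_1+2n_2+\dots+kn_k=n}}\ \prod_{j=1}^k\left(\frac{\lambda^{(1)}_j}{\lambda^{(2)}_j}\right)^{n_j/2}\sum_{m_1,\dots,m_k=0}^\infty\ \prod_{j=1}^k\frac{\left(\sqrt{\lambda^{(1)}_j\lambda^{(2)}_j}\,s^\alpha t^\beta\right)^{2m_j+|n_j|}}{(|n_j|+m_j)!\,m_j!}\ {}_2\Psi_2\left[\begin{matrix}(N+1,1),&(N+1,1)\\(N\alpha+1,\alpha),&(N\beta+1,\beta)\end{matrix}\,\middle|\,-(\Lambda^{(1)}+\Lambda^{(2)})s^\alpha t^\beta\right],$$ where $N=\sum_{j=1}^k(2m_j+|n_j|)$ and $0^0=1$. All the series occurring here (the Wright series, the sum over $m_1,\dots,m_k$ and the sum over $n_1,\dots,n_k$) converge absolutely. -/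

import Mathlib

open MeasureTheory ProbabilityTheory
open scoped NNReal Nat

noncomputable section

/-- The closed quadrant `ℝ₊²`, with its product order. -/
abbrev Quadrant : Type := ℝ≥0 × ℝ≥0

/-- The half-open rectangle `(p₁, q₁] × (p₂, q₂]`. -/
def rectangle (p q : Quadrant) : Set Quadrant :=
  Set.Ioc p.1 q.1 ×ˢ Set.Ioc p.2 q.2

/-- The increment of a two-parameter process over the rectangle `(p₁, q₁] × (p₂, q₂]`. -/
def rectIncrement {Ω : Type*} (X : Quadrant → Ω → ℤ) (p q : Quadrant) (ω : Ω) : ℤ :=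
  X q ω - X (q.1, p.2) ω - X (p.1, q.2) ω + X p ω

/-- The finite set of all `(v₁, …, v_k) ∈ ℕ₀ᵏ` with `∑ j v_j = n`; the entry `v_j` is indexed by
`j - 1 : Fin k`. Each entry of such a vector is at most `n`. -/
def thetaNat (k n : ℕ) : Finset (Fin k → ℕ) :=
  (Fintype.piFinset fun _ : Fin k => Finset.range (n + 1)).filter
    fun v => ∑ j : Fin k, ((j : ℕ) + 1) * v j = n

theorem mem_thetaNat {k n : ℕ} (v : Fin k → ℕ) :
    v ∈ thetaNat k n ↔ ∑ j : Fin k, ((j : ℕ) + 1) * v j = n := by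
  unfold thetaNat
  rw [Finset.mem_filter]
  refine ⟨fun h => h.2, fun h => ⟨?_, h⟩⟩
  rw [Fintype.mem_piFinset]
  intro j
  have h1 : ((j : ℕ) + 1) * v j ≤ ∑ j : Fin k, ((j : ℕ) + 1) * v j :=
    Finset.single_le_sum (f := fun j : Fin k => ((j : ℕ) + 1) * v j)
      (fun _ _ => Nat.zero_le _) (Finset.mem_univ j)
  have h2 : v j ≤ ((j : ℕ) + 1) * v j := Nat.le_mul_of_pos_left _ (Nat.succ_pos _)
  rw [Finset.mem_range]
  omega

/-- The set of all `(v₁, …, v_k) ∈ ℤᵏ` with `∑ j v_j = n`. -/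
def thetaInt (k : ℕ) (n : ℤ) : Set (Fin k → ℤ) :=
  {v | ∑ j : Fin k, (((j : ℕ) : ℤ) + 1) * v j = n}

/-- `M` is a two-parameter generalized Poisson random field with (positive) rates `lam`:
it vanishes on the axes, has independent increments over disjoint rectangles, and these have the
generalized Poisson law. Almost every path is continuous from the upper right, as the
distribution function `(s, t) ↦ M([0, s] × [0, t])` of a measure is. -/
structure IsGPRF {Ω : Type*} [MeasurableSpace Ω] (P : Measure Ω) {k : ℕ} (lam : Fin k → ℝ)
    (M : Quadrant → Ω → ℕ) : Prop where
  rate_pos : ∀ j, 0 < lam j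
  measurable : ∀ p, Measurable (M p)
  zero_left : ∀ t : ℝ≥0, ∀ᵐ ω ∂P, M (0, t) ω = 0
  zero_right : ∀ s : ℝ≥0, ∀ᵐ ω ∂P, M (s, 0) ω = 0
  right_continuous : ∀ᵐ ω ∂P, ∀ p, ContinuousWithinAt (fun q => M q ω) (Set.Ici p) p
  increment_law : ∀ p q : Quadrant, p.1 < q.1 → p.2 < q.2 → ∀ n : ℕ,
    P.real {ω | rectIncrement (fun x ω => (M x ω : ℤ)) p q ω = n} =
      ∑ v ∈ thetaNat k n, ∏ j : Fin k,
        (lam j * (((q.1 : ℝ) - p.1) * ((q.2 : ℝ) - p.2))) ^ v j / ((v j)! : ℝ) *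
          Real.exp (-(lam j * (((q.1 : ℝ) - p.1) * ((q.2 : ℝ) - p.2))))
  indep_increments : ∀ (m : ℕ) (p q : Fin m → Quadrant), (∀ i, p i ≤ q i) →
    (Pairwise fun i i' => Disjoint (rectangle (p i) (q i)) (rectangle (p i') (q i'))) →
    iIndepFun (fun i => rectIncrement (fun x ω => (M x ω : ℤ)) (p i) (q i)) P

/-- The σ-algebra generated by a process. -/
abbrev generatedSigma {Ω ι E : Type*} [MeasurableSpace E] (X : ι → Ω → E) : MeasurableSpace Ω :=
  ⨆ i, MeasurableSpace.comap (X i) inferInstance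

/-- `S` is the generalized Skellam point process on `ℝ₊²` with rates `lam₁`, `lam₂`: the difference
of two independent generalized Poisson random fields. -/
def IsGSPP {Ω : Type*} [MeasurableSpace Ω] (P : Measure Ω) {k : ℕ} (lam₁ lam₂ : Fin k → ℝ)
    (S : Quadrant → Ω → ℤ) : Prop :=
  ∃ M₁ M₂ : Quadrant → Ω → ℕ, IsGPRF P lam₁ M₁ ∧ IsGPRF P lam₂ M₂ ∧
    Indep (generatedSigma M₁) (generatedSigma M₂) P ∧
    ∀ p ω, S p ω = (M₁ p ω : ℤ) - (M₂ p ω : ℤ)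

/-- `H` is a stable subordinator of index `α`: a Lévy process with almost surely non-decreasing
paths (hence almost surely non-negative, as it starts at `0`) and Laplace transform
`E exp (-u H t) = exp (-t u ^ α)`. -/
structure IsStableSubordinator {Ω : Type*} [MeasurableSpace Ω] (P : Measure Ω) (α : ℝ)
    (H : ℝ≥0 → Ω → ℝ) : Prop where
  measurable : ∀ t, Measurable (H t)
  zero : ∀ᵐ ω ∂P, H 0 ω = 0
  indep_increments : HasIndepIncrements H P
  stationary_increments : ∀ t h : ℝ≥0,
    IdentDistrib (fun ω => H (t + h) ω - H t ω) (H h) P P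
  monotone : ∀ᵐ ω ∂P, Monotone fun t => H t ω
  right_continuous : ∀ᵐ ω ∂P, ∀ t, ContinuousWithinAt (fun x => H x ω) (Set.Ici t) t
  laplace : ∀ (t : ℝ≥0) (u : ℝ), 0 < u →
    ∫ ω, Real.exp (-(u * H t ω)) ∂P = Real.exp (-((t : ℝ) * u ^ α))

/-- `L` is an inverse stable subordinator of index `α`: the hitting time process
`L t = inf {x ≥ 0 : H x ≥ t}` of a stable subordinator `H`. (Almost surely `H` is unbounded, so that
the infimum is over a non-empty set for every `t`.) -/
def IsInverseStableSubordinator {Ω : Type*} [MeasurableSpace Ω] (P : Measure Ω) (α : ℝ)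
    (L : ℝ≥0 → Ω → ℝ≥0) : Prop :=
  (∀ t, Measurable (L t)) ∧
  ∃ H : ℝ≥0 → Ω → ℝ, IsStableSubordinator P α H ∧
    ∀ᵐ ω ∂P, ∀ t : ℝ≥0, L t ω = sInf {x : ℝ≥0 | (t : ℝ) ≤ H x ω}

/-- The `r`-th term of the series of the generalized Wright function, with upper parameters
`A i = (a_i, α_i)` and lower parameters `B j = (b_j, β_j)`. -/
def wrightTerm {m l : ℕ} (A : Fin m → ℝ × ℝ) (B : Fin l → ℝ × ℝ) (x : ℝ) (r : ℕ) : ℝ :=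
  (∏ i, Real.Gamma ((A i).2 * r + (A i).1)) /
    ((∏ j, Real.Gamma ((B j).2 * r + (B j).1)) * (r ! : ℝ)) * x ^ r

/-- The generalized Wright function `ₘΨₗ` at `x`. -/
def generalizedWright {m l : ℕ} (A : Fin m → ℝ × ℝ) (B : Fin l → ℝ × ℝ) (x : ℝ) : ℝ :=
  ∑' r : ℕ, wrightTerm A B x r

/-- Upper parameters `(N + 1, 1), (N + 1, 1)`. -/
def upperParams (N : ℕ) : Fin 2 → ℝ × ℝ :=
  ![((N : ℝ) + 1, 1), ((N : ℝ) + 1, 1)]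

/-- Lower parameters `(N α + 1, α), (N β + 1, β)`. -/
def lowerParams (α β : ℝ) (N : ℕ) : Fin 2 → ℝ × ℝ :=
  ![((N : ℝ) * α + 1, α), ((N : ℝ) * β + 1, β)]

/-- The term of index `(m₁, …, m_k)` of the inner multiple series attached to
`(v₁, …, v_k) ∈ ℤᵏ`. -/
def skellamTerm {k : ℕ} (lam₁ lam₂ : Fin k → ℝ) (α β s t : ℝ)
    (v : Fin k → ℤ) (m : Fin k → ℕ) : ℝ :=
  (∏ j, (√(lam₁ j * lam₂ j) * s ^ α * t ^ β) ^ (2 * m j + (v j).natAbs) /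
      ((((v j).natAbs + m j)! : ℝ) * ((m j)! : ℝ))) *
    generalizedWright
      (upperParams (∑ j, (2 * m j + (v j).natAbs)))
      (lowerParams α β (∑ j, (2 * m j + (v j).natAbs)))
      (-(∑ j, lam₁ j + ∑ j, lam₂ j) * s ^ α * t ^ β)

end

/-! Condition on the two random times. At a fixed point of area `a`, each field has the law of a
weighted sum of independent Poisson numbers, so the Skellam law is a sum over pairs of multiplicity
vectors. Describing a pair by its difference `u` and pointwise minimum `m` turns each product of
Poisson weights into `skellamCoeff * a ^ N * exp (-Λ a)`, where `N = ∑ (2 m_j + |u_j|)` and `Λ` is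
the total rate (`IsGSPP.measure_eq_tsum`). By independence `a` may be replaced by `L s * L' t`
(`measure_random_evaluation`). All terms are nonnegative, so Tonelli moves the expectation inside
the sums.

What remains is the expectation of `(L s * L' t) ^ N * exp (-Λ (L s * L' t))`. Expanding the
exponential and using independence reduces it to the moments `M! s ^ (α M) / Γ(α M + 1)` of an
inverse stable subordinator, and the resulting series is the Wright function
(`integral_mul_pow_mul_exp`). The moments come from the identity in law of `L s` with `(s / H 1) ^
α`; the negative moments of `H 1` are Mellin integrals of its Laplace transform.

The exponential series has signs, so exchanging it with the expectation needs absolute convergence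
of the Wright series. This is a ratio test: the ratios are bounded by a quantity asymptotic to `M ^
(1 - α - β) * α ^ (-α) * β ^ (-β) * |x|` with `M = N + r` (`summable_wrightTerm`). The outer sums
need no estimate: their terms are nonnegative and add up to a probability. -/

/-! ### Laws determined by moments and by Laplace transforms -/

/-- A finite measure on a bounded subset of the line is determined by its moments. -/
theorem measure_eq_of_forall_integral_pow_eq {μ ν : Measure ℝ} [IsFiniteMeasure μ]
    [IsFiniteMeasure ν] {C : ℝ} (hμ : ∀ᵐ x ∂μ, |x| ≤ C) (hν : ∀ᵐ x ∂ν, |x| ≤ C)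
    (h : ∀ n : ℕ, ∫ x, x ^ n ∂μ = ∫ x, x ^ n ∂ν) : μ = ν := by
  -- On a bounded support the characteristic function is the power series of the moments; the terms
  -- are dominated by `(|t| * C) ^ n / n!`.
  have key : ∀ (ρ : Measure ℝ) [IsFiniteMeasure ρ], (∀ᵐ x ∂ρ, |x| ≤ C) → ∀ t : ℝ,
      HasSum (fun n : ℕ => (t * Complex.I) ^ n / (n ! : ℂ) * ((∫ x, x ^ n ∂ρ : ℝ) : ℂ))
        (charFun ρ t) := by
    intro ρ _ hρ t
    rw [charFun_apply_real]
    have hs : ∀ x : ℝ, HasSum (fun n : ℕ => (t * Complex.I) ^ n / (n ! : ℂ) * ((x ^ n : ℝ) : ℂ))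
        (Complex.exp (t * x * Complex.I)) := by
      intro x
      have := NormedSpace.expSeries_div_hasSum_exp (t * x * Complex.I : ℂ)
      rw [← Complex.exp_eq_exp_ℂ] at this
      refine this.congr_fun fun n => ?_
      push_cast
      rw [mul_pow, mul_pow, mul_pow]
      ring
    have := hasSum_integral_of_dominated_convergence (μ := ρ)
      (F := fun (n : ℕ) (x : ℝ) => (t * Complex.I) ^ n / (n ! : ℂ) * ((x ^ n : ℝ) : ℂ))
      (f := fun x => Complex.exp (t * x * Complex.I))
      (fun n _ => (|t| * C) ^ n / (n ! : ℝ))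
      (fun n => by fun_prop) (fun n => ?_) (.of_forall fun _ => Real.summable_pow_div_factorial _)
      (integrable_const _) (.of_forall hs)
    · simpa only [integral_const_mul, integral_complex_ofReal] using this
    · filter_upwards [hρ] with x hx
      simp only [norm_mul, norm_div, norm_pow, Complex.norm_real, Complex.norm_I, mul_one,
        Complex.norm_natCast, Real.norm_eq_abs]
      rw [mul_pow, mul_div_right_comm]
      gcongr
  refine Measure.ext_of_charFun (funext fun t => ?_)
  refine (key μ hμ t).unique ?_
  simp_rw [h]
  exact key ν hν t

/-- The law of a non-negative random variable is determined by its Laplace transform. -/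
theorem map_eq_of_laplace_eq {Ω : Type*} [MeasurableSpace Ω] {P : Measure Ω}
    [IsProbabilityMeasure P] {X Y : Ω → ℝ} (hX : Measurable X) (hY : Measurable Y)
    (hX0 : ∀ᵐ ω ∂P, 0 ≤ X ω) (hY0 : ∀ᵐ ω ∂P, 0 ≤ Y ω)
    (h : ∀ u : ℝ, 0 < u → ∫ ω, Real.exp (-(u * X ω)) ∂P = ∫ ω, Real.exp (-(u * Y ω)) ∂P) :
    P.map X = P.map Y := by
  have hXe : Measurable fun ω => Real.exp (-X ω) := by fun_prop
  have hYe : Measurable fun ω => Real.exp (-Y ω) := by fun_prop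
  have bound : ∀ Z : Ω → ℝ, Measurable Z → (∀ᵐ ω ∂P, 0 ≤ Z ω) →
      ∀ᵐ x ∂(P.map fun ω => Real.exp (-Z ω)), |x| ≤ 1 := by
    intro Z hZ hZ0
    rw [ae_map_iff (by fun_prop) (measurableSet_le (by fun_prop) (by fun_prop))]
    filter_upwards [hZ0] with ω hω
    rw [abs_of_pos (Real.exp_pos _)]
    exact Real.exp_le_one_iff.2 (by linarith)
  -- `exp (-X)` lies in `[0, 1]` almost surely and its `n`-th moment is the Laplace transform at `u
  -- = n`, so integer arguments suffice.
  have hW : P.map (fun ω => Real.exp (-X ω)) = P.map (fun ω => Real.exp (-Y ω)) := by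
    have := Measure.isProbabilityMeasure_map (μ := P) hXe.aemeasurable
    have := Measure.isProbabilityMeasure_map (μ := P) hYe.aemeasurable
    refine measure_eq_of_forall_integral_pow_eq (bound X hX hX0) (bound Y hY hY0) fun n => ?_
    rw [integral_map hXe.aemeasurable (by fun_prop), integral_map hYe.aemeasurable (by fun_prop)]
    rcases Nat.eq_zero_or_pos n with rfl | hn
    · simp
    · have := h n (by exact_mod_cast hn)
      simp_rw [← Real.exp_nat_mul, mul_neg]
      exact this
  have hl : ∀ Z : Ω → ℝ, Measurable Z →
      (P.map fun ω => Real.exp (-Z ω)).map (fun x => -Real.log x) = P.map Z := by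
    intro Z hZ
    rw [Measure.map_map (by fun_prop) (by fun_prop)]
    congr 1
    funext ω
    simp
  rw [← hl X hX, ← hl Y hY, hW]

/-! ### Stable subordinators: tails, self-similarity, negative moments -/

namespace IsStableSubordinator

variable {Ω : Type*} [MeasurableSpace Ω] {P : Measure Ω} {α : ℝ} {H : ℝ≥0 → Ω → ℝ}

theorem ae_nonneg (h : IsStableSubordinator P α H) : ∀ᵐ ω ∂P, ∀ x, 0 ≤ H x ω := by
  filter_upwards [h.zero, h.monotone] with ω h0 hm x
  rw [← h0]
  exact hm zero_le

theorem integrable_exp [IsProbabilityMeasure P] (h : IsStableSubordinator P α H) (x : ℝ≥0) {u : ℝ}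
    (hu : 0 < u) : Integrable (fun ω => Real.exp (-(u * H x ω))) P := by
  refine .of_integral_ne_zero ?_
  rw [h.laplace x u hu]
  exact (Real.exp_pos _).ne'

/-- Chernoff bound for the lower tail. -/
theorem measureReal_lt_le [IsProbabilityMeasure P] (h : IsStableSubordinator P α H) (x : ℝ≥0)
    (t : ℝ) {u : ℝ} (hu : 0 < u) :
    P.real {ω | H x ω < t} ≤ Real.exp (u * t - x * u ^ α) := by
  have hm : MeasurableSet {ω | H x ω < t} := measurableSet_lt (h.measurable x) measurable_const
  have : P.real {ω | H x ω < t} ≤ ∫ ω, Real.exp (u * t) * Real.exp (-(u * H x ω)) ∂P := by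
    rw [← integral_indicator_one hm]
    refine integral_mono_of_nonneg (.of_forall fun ω => Set.indicator_nonneg (by simp) _)
      ((h.integrable_exp x hu).const_mul _) (.of_forall fun ω => ?_)
    by_cases hω : H x ω < t
    · simp only [Set.mem_ofPred_eq, hω, Set.indicator_of_mem, Pi.one_apply, ← Real.exp_add]
      exact Real.one_le_exp (by nlinarith)
    · simp only [Set.mem_ofPred_eq, hω, not_false_eq_true, Set.indicator_of_notMem]
      positivity
  rwa [integral_const_mul, h.laplace x u hu, ← Real.exp_add, ← sub_eq_add_neg] at this

/-- The Chernoff bound with `u = 1` at time `n` is `exp (t - n)`. This keeps the infimum defining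
the inverse away from the empty set, where `sInf` takes the default value `0`. -/
theorem ae_exists_le [IsProbabilityMeasure P] (h : IsStableSubordinator P α H) (t : ℝ) :
    ∀ᵐ ω ∂P, ∃ x, t ≤ H x ω := by
  have hlim : Filter.Tendsto (fun n : ℕ => Real.exp (1 * t - ((n : ℝ≥0) : ℝ) * 1 ^ α))
      Filter.atTop (nhds 0) := by
    simp only [Real.one_rpow, mul_one, one_mul, NNReal.coe_natCast]
    refine Real.tendsto_exp_atBot.comp ?_
    exact Filter.tendsto_atBot_add_const_left _ _
      (Filter.tendsto_neg_atTop_atBot.comp tendsto_natCast_atTop_atTop)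
  have : P.real {ω | ¬ ∃ x, t ≤ H x ω} = 0 := by
    refine le_antisymm (ge_of_tendsto' hlim fun n => ?_) measureReal_nonneg
    refine le_trans (measureReal_mono fun ω hω => ?_) (h.measureReal_lt_le n t one_pos)
    simp only [not_exists, not_le, Set.mem_ofPred_eq] at hω
    exact hω n
  exact (measureReal_eq_zero_iff).1 this

/-- The Chernoff bound at level `1 / n` with `u = n` is `exp (1 - n ^ α)`, which tends to `0`. -/
theorem ae_pos [IsProbabilityMeasure P] (hα : 0 < α) (h : IsStableSubordinator P α H) :
    ∀ᵐ ω ∂P, 0 < H 1 ω := by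
  have hlim : Filter.Tendsto (fun n : ℕ => Real.exp (1 - (n : ℝ) ^ α))
      Filter.atTop (nhds 0) := by
    refine Real.tendsto_exp_atBot.comp ?_
    exact Filter.tendsto_atBot_add_const_left _ _
      (Filter.tendsto_neg_atTop_atBot.comp
        ((tendsto_rpow_atTop hα).comp tendsto_natCast_atTop_atTop))
  have : P.real {ω | ¬ 0 < H 1 ω} = 0 := by
    refine le_antisymm (ge_of_tendsto hlim ?_) measureReal_nonneg
    filter_upwards [Filter.eventually_gt_atTop 0] with n hn
    have hn' : (0 : ℝ) < n := by exact_mod_cast hn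
    refine le_trans (measureReal_mono fun ω hω => ?_)
      ((h.measureReal_lt_le 1 (1 / n) hn').trans_eq ?_)
    · simp only [Set.mem_ofPred_eq, not_lt] at hω ⊢
      exact hω.trans_lt (by positivity)
    · rw [mul_one_div_cancel hn'.ne', NNReal.coe_one, one_mul]
  exact (measureReal_eq_zero_iff).1 this

/-- Self-similarity of the one-dimensional laws. -/
theorem map_eq [IsProbabilityMeasure P] (hα : 0 < α) (h : IsStableSubordinator P α H) (x : ℝ≥0) :
    P.map (H x) = P.map fun ω => (x : ℝ) ^ α⁻¹ * H 1 ω := by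
  refine map_eq_of_laplace_eq (h.measurable x) ((h.measurable 1).const_mul _) ?_ ?_ fun u hu => ?_
  · filter_upwards [h.ae_nonneg] with ω hω using hω x
  · filter_upwards [h.ae_nonneg] with ω hω using mul_nonneg (by positivity) (hω 1)
  · rw [h.laplace x u hu]
    rcases eq_or_ne x 0 with rfl | hx
    · simp [Real.zero_rpow (inv_ne_zero hα.ne')]
    · have hx' : (0 : ℝ) < x := by positivity
      simp_rw [← mul_assoc]
      rw [h.laplace 1 _ (by positivity), Real.mul_rpow hu.le (by positivity), ← Real.rpow_mul hx'.le,
        inv_mul_cancel₀ hα.ne']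
      simp [mul_comm]

/-- Negative moments of the stable law. -/
theorem lintegral_rpow_neg [IsProbabilityMeasure P] (hα : 0 < α) (h : IsStableSubordinator P α H)
    (m : ℕ) :
    ∫⁻ ω, ENNReal.ofReal (H 1 ω ^ (-(α * m))) ∂P =
      ENNReal.ofReal ((m ! : ℝ) / Real.Gamma (α * m + 1)) := by
  rcases Nat.eq_zero_or_pos m with rfl | hm
  · simp
  have hm' : (0 : ℝ) < m := by exact_mod_cast hm
  set q : ℝ := α * m with hq
  have hq0 : 0 < q := by positivity
  have hΓ : 0 < Real.Gamma q := Real.Gamma_pos_of_pos hq0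
  have hH := h.measurable 1
  -- Euler's integral writes `H ^ (-q)` as a mixture of exponentials `exp (-u H)`, whose
  -- expectations are known. It needs `q > 0`, hence the separate case `m = 0`.
  have h1 : ∀ᵐ ω ∂P, ENNReal.ofReal (H 1 ω ^ (-q)) = ENNReal.ofReal (Real.Gamma q)⁻¹ *
      ∫⁻ u in Set.Ioi (0 : ℝ), ENNReal.ofReal (u ^ (q - 1) * Real.exp (-(u * H 1 ω))) := by
    filter_upwards [h.ae_pos hα] with ω hω
    have hI := Real.integral_rpow_mul_exp_neg_mul_Ioi hq0 hω
    have hint : IntegrableOn (fun u : ℝ => u ^ (q - 1) * Real.exp (-(H 1 ω * u))) (Set.Ioi 0) := by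
      refine .of_integral_ne_zero ?_
      rw [hI]
      positivity
    simp_rw [mul_comm _ (H 1 ω)]
    rw [← ofReal_integral_eq_lintegral_ofReal hint, hI, ← ENNReal.ofReal_mul (by positivity)]
    · congr 1
      rw [one_div, Real.inv_rpow hω.le, Real.rpow_neg hω.le]
      field_simp
    · refine (ae_restrict_iff' measurableSet_Ioi).2 (.of_forall fun u (hu : 0 < u) => ?_)
      show 0 ≤ u ^ (q - 1) * Real.exp (-(H 1 ω * u))
      positivity
  have h2 : ∀ u ∈ Set.Ioi (0 : ℝ), ∫⁻ ω, ENNReal.ofReal (u ^ (q - 1) * Real.exp (-(u * H 1 ω))) ∂P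
      = ENNReal.ofReal (u ^ (q - 1) * Real.exp (-1 * u ^ α)) := by
    intro u hu
    have hu' : 0 < u := hu
    rw [← ofReal_integral_eq_lintegral_ofReal ((h.integrable_exp 1 hu').const_mul _)
      (.of_forall fun ω => by positivity), integral_const_mul, h.laplace 1 u hu']
    simp
  have hI := integral_rpow_mul_exp_neg_mul_rpow (p := α) (q := q - 1) (b := 1) hα (by linarith)
    one_pos
  have hqa : (q - 1 + 1) / α = m := by rw [hq]; field_simp; ring
  rw [Real.one_rpow, hqa, one_mul] at hI
  have hint : IntegrableOn (fun u : ℝ => u ^ (q - 1) * Real.exp (-1 * u ^ α)) (Set.Ioi 0) := by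
    refine .of_integral_ne_zero ?_
    rw [hI]
    have := Real.Gamma_pos_of_pos hm'
    positivity
  rw [lintegral_congr_ae h1, lintegral_const_mul _ (by fun_prop),
    lintegral_lintegral_swap (by fun_prop),
    setLIntegral_congr_fun measurableSet_Ioi h2, ← ofReal_integral_eq_lintegral_ofReal hint, hI,
    ← ENNReal.ofReal_mul (by positivity)]
  · congr 1
    rw [Real.Gamma_add_one hq0.ne', hq, ← Nat.succ_pred_eq_of_pos hm, Nat.factorial_succ]
    have := Real.Gamma_nat_eq_factorial m.pred
    simp only [Nat.succ_eq_add_one] at hm' ⊢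
    push_cast
    rw [this]
    have : (m.pred : ℝ) + 1 ≠ 0 := by positivity
    field_simp
  · refine (ae_restrict_iff' measurableSet_Ioi).2 (.of_forall fun u (hu : 0 < u) => ?_)
    show 0 ≤ u ^ (q - 1) * Real.exp (-1 * u ^ α)
    positivity

end IsStableSubordinator

/-! ### Moments of the inverse stable subordinator -/

namespace IsInverseStableSubordinator

variable {Ω : Type*} [MeasurableSpace Ω] {P : Measure Ω} {α : ℝ} {L : ℝ≥0 → Ω → ℝ≥0}

theorem lintegral_pow [IsProbabilityMeasure P] (hα : 0 < α)
    (h : IsInverseStableSubordinator P α L) (t : ℝ≥0) (m : ℕ) :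
    ∫⁻ ω, (L t ω : ENNReal) ^ m ∂P =
      ENNReal.ofReal ((m ! : ℝ) * ((t : ℝ) ^ α) ^ m / Real.Gamma (α * m + 1)) := by
  obtain ⟨hLm, H, hH, hLH⟩ := h
  have hH1 := hH.measurable 1
  -- `L t ≤ x` means `t ≤ H x`, which by self-similarity has the probability of `t ≤ x ^ (1/α) * H
  -- 1`, that is, of `(t / H 1) ^ α ≤ x`.
  have hlaw : P.map (L t) = P.map fun ω => (((t : ℝ) / H 1 ω) ^ α).toNNReal := by
    have := Measure.isProbabilityMeasure_map (μ := P) (hLm t).aemeasurable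
    refine Measure.ext_of_Iic _ _ fun x => ?_
    rw [Measure.map_apply (hLm t) measurableSet_Iic,
      Measure.map_apply (by fun_prop) measurableSet_Iic]
    have e1 : P (L t ⁻¹' Set.Iic x) = P (H x ⁻¹' Set.Ici (t : ℝ)) := by
      refine measure_congr ?_
      filter_upwards [hLH, hH.monotone, hH.right_continuous, hH.ae_exists_le t]
        with ω hω hmono hrc hex
      refine propext ?_
      show L t ω ≤ x ↔ (t : ℝ) ≤ H x ω
      rw [hω t]
      refine ⟨fun hle => ?_, fun hle => csInf_le (OrderBot.bddBelow _) hle⟩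
      -- The infimum might not be attained a priori: the inequality holds at every `y > x` and
      -- passes to `x` by right-continuity.
      have hgt : ∀ y, x < y → (t : ℝ) ≤ H y ω := by
        intro y hy
        obtain ⟨z, hz, hzy⟩ := exists_lt_of_csInf_lt hex (hle.trans_lt hy)
        exact le_trans hz (hmono hzy.le)
      have hc : Filter.Tendsto (fun y => H y ω) (nhdsWithin x (Set.Ioi x)) (nhds (H x ω)) :=
        (hrc x).mono_left (nhdsWithin_mono _ Set.Ioi_subset_Ici_self)
      exact ge_of_tendsto hc (by filter_upwards [self_mem_nhdsWithin] with y hy using hgt y hy)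
    have e2 : P (H x ⁻¹' Set.Ici (t : ℝ)) =
        P ((fun ω => (x : ℝ) ^ α⁻¹ * H 1 ω) ⁻¹' Set.Ici (t : ℝ)) := by
      rw [← Measure.map_apply (hH.measurable x) measurableSet_Ici, hH.map_eq hα x,
        Measure.map_apply (by fun_prop) measurableSet_Ici]
    rw [e1, e2]
    refine measure_congr ?_
    filter_upwards [hH.ae_pos hα] with ω hω
    refine propext ?_
    show (t : ℝ) ≤ (x : ℝ) ^ α⁻¹ * H 1 ω ↔ (((t : ℝ) / H 1 ω) ^ α).toNNReal ≤ x
    rw [Real.toNNReal_le_iff_le_coe, ← div_le_iff₀ hω,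
      Real.le_rpow_inv_iff_of_pos (by positivity) (by positivity) hα]
  have h1 : ∫⁻ ω, (L t ω : ENNReal) ^ m ∂P = ∫⁻ y, (y : ENNReal) ^ m ∂(P.map (L t)) := by
    rw [lintegral_map (by fun_prop) (hLm t)]
  rw [h1, hlaw, lintegral_map (by fun_prop) (by fun_prop)]
  have h2 : ∀ᵐ ω ∂P, (((((t : ℝ) / H 1 ω) ^ α).toNNReal : ℝ≥0) : ENNReal) ^ m =
      ENNReal.ofReal (((t : ℝ) ^ α) ^ m) * ENNReal.ofReal (H 1 ω ^ (-(α * m))) := by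
    filter_upwards [hH.ae_pos hα] with ω hω
    change ENNReal.ofReal _ ^ m = _
    rw [← ENNReal.ofReal_pow (by positivity), ← ENNReal.ofReal_mul (by positivity),
      Real.div_rpow t.coe_nonneg hω.le, div_pow, Real.rpow_neg hω.le, Real.rpow_mul hω.le,
      Real.rpow_natCast]
    rfl
  rw [lintegral_congr_ae h2, lintegral_const_mul _ (by fun_prop), hH.lintegral_rpow_neg hα,
    ← ENNReal.ofReal_mul (by positivity)]
  congr 1
  ring

theorem integrable_pow [IsProbabilityMeasure P] (hα : 0 < α)
    (h : IsInverseStableSubordinator P α L) (t : ℝ≥0) (m : ℕ) :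
    Integrable (fun ω => (L t ω : ℝ) ^ m) P := by
  have hm := h.1 t
  refine ⟨by fun_prop, ?_⟩
  have : ∀ ω, ‖(L t ω : ℝ) ^ m‖ₑ = (L t ω : ENNReal) ^ m := fun ω => by
    rw [enorm_pow, NNReal.enorm_eq]
  rw [HasFiniteIntegral]
  simp_rw [this]
  rw [h.lintegral_pow hα]
  exact ENNReal.ofReal_lt_top

/-- The moments of the inverse stable subordinator. -/
theorem integral_pow [IsProbabilityMeasure P] (hα : 0 < α)
    (h : IsInverseStableSubordinator P α L) (t : ℝ≥0) (m : ℕ) :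
    ∫ ω, (L t ω : ℝ) ^ m ∂P = (m ! : ℝ) * ((t : ℝ) ^ α) ^ m / Real.Gamma (α * m + 1) := by
  have hm := h.1 t
  have := h.lintegral_pow hα t m
  rw [integral_eq_lintegral_of_nonneg_ae (.of_forall fun ω => by positivity) (by fun_prop)]
  have e : ∀ ω, ENNReal.ofReal ((L t ω : ℝ) ^ m) = (L t ω : ENNReal) ^ m := fun ω => by
    rw [ENNReal.ofReal_pow (by positivity), ENNReal.ofReal_coe_nnreal]
  simp_rw [e]
  rw [this, ENNReal.toReal_ofReal]
  have := Real.Gamma_pos_of_pos (show 0 < α * m + 1 by positivity)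
  positivity

end IsInverseStableSubordinator

/-! ### Absolute convergence of the Wright series -/

theorem wrightTerm_upperParams_lowerParams (α β : ℝ) (N : ℕ) (x : ℝ) (r : ℕ) :
    wrightTerm (upperParams N) (lowerParams α β N) x r =
      ((N + r)! : ℝ) ^ 2 / (Real.Gamma (α * (N + r : ℕ) + 1) * Real.Gamma (β * (N + r : ℕ) + 1) *
        (r ! : ℝ)) * x ^ r := by
  have e1 : (1 : ℝ) * r + (N + 1) = ((N + r : ℕ) : ℝ) + 1 := by push_cast; ring
  have e2 : ∀ γ : ℝ, γ * r + (N * γ + 1) = γ * (N + r : ℕ) + 1 := by intro γ; push_cast; ring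
  simp only [wrightTerm, upperParams, lowerParams, Fin.prod_univ_two, Matrix.cons_val_zero,
    Matrix.cons_val_one]
  rw [e1, e2, e2, Real.Gamma_nat_eq_factorial, sq]

/-- Wendel's lower bound for the quotient of Gamma values. -/
theorem Real.mul_Gamma_le_rpow_mul_Gamma_add {y a : ℝ} (hy : 0 < y) (ha : 0 < a) (ha1 : a < 1) :
    y * Real.Gamma y ≤ (y + a) ^ (1 - a) * Real.Gamma (y + a) := by
  -- Log-convexity of Gamma at `y + 1 = a (y + a) + (1 - a) (y + a + 1)`.
  have h := Real.Gamma_mul_add_mul_le_rpow_Gamma_mul_rpow_Gamma (s := y + a) (t := y + a + 1)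
    (a := a) (b := 1 - a) (by linarith) (by linarith) ha (by linarith) (by ring)
  have hΓ := Real.Gamma_pos_of_pos (show 0 < y + a by linarith)
  rw [show a * (y + a) + (1 - a) * (y + a + 1) = y + 1 by ring, Real.Gamma_add_one hy.ne',
    Real.Gamma_add_one (by linarith : y + a ≠ 0), Real.mul_rpow (by linarith) hΓ.le,
    mul_left_comm, ← Real.rpow_add hΓ] at h
  simpa using h

open Filter Topology in
/-- The Wright series converges below its critical growth. -/
theorem summable_wrightTerm {α β : ℝ} (hα : 0 < α ∧ α < 1) (hβ : 0 < β ∧ β < 1) (N : ℕ) {x : ℝ}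
    (h : 1 < α + β ∨ (α + β = 1 ∧ |x| < α ^ α * β ^ β) ∨ x = 0) :
    Summable (wrightTerm (upperParams N) (lowerParams α β N) x) := by
  by_cases hx : x = 0
  · refine summable_of_ne_finset_zero (s := {0}) fun r hr => ?_
    rw [wrightTerm_upperParams_lowerParams, hx, zero_pow (by simpa using hr), mul_zero]
  -- `Γ(γ M + 1) / Γ(γ M + 1 + γ) ≤ M ^ (-γ) * G γ M` with `G γ M → γ ^ (-γ)`
  set G : ℝ → ℕ → ℝ := fun γ r =>
    ((γ * (N + r : ℕ) + 1 + γ) / (N + r : ℕ)) ^ (1 - γ) / ((γ * (N + r : ℕ) + 1) / (N + r : ℕ))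
    with hG
  have hM : Tendsto (fun r : ℕ => ((N + r : ℕ) : ℝ)) atTop atTop :=
    tendsto_natCast_atTop_atTop.comp (tendsto_atTop_mono (fun r => Nat.le_add_left r N) tendsto_id)
  have hinv : Tendsto (fun r : ℕ => ((N + r : ℕ) : ℝ)⁻¹) atTop (𝓝 0) :=
    tendsto_inv_atTop_zero.comp hM
  have hMpos : ∀ᶠ r : ℕ in atTop, (0 : ℝ) < (N + r : ℕ) := hM.eventually_gt_atTop 0
  have hlin : ∀ γ c : ℝ, Tendsto (fun r : ℕ => (γ * (N + r : ℕ) + c) / (N + r : ℕ)) atTop (𝓝 γ) := by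
    intro γ c
    have := (hinv.const_mul c).const_add γ
    rw [mul_zero, add_zero] at this
    refine this.congr' ?_
    filter_upwards [hMpos] with r hr
    field_simp
  have hGlim : ∀ γ : ℝ, 0 < γ → Tendsto (G γ) atTop (𝓝 (γ ^ (-γ))) := by
    intro γ hγ
    have h1 := ((hlin γ (1 + γ)).rpow_const (p := 1 - γ) (Or.inl hγ.ne')).div (hlin γ 1) hγ.ne'
    have e : γ ^ (1 - γ) / γ = γ ^ (-γ) := by
      rw [← Real.rpow_sub_one hγ.ne']
      congr 1
      ring
    rw [e] at h1
    refine h1.congr fun r => ?_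
    simp only [hG, Pi.div_apply, add_assoc]
  have hGbound : ∀ γ : ℝ, 0 < γ ∧ γ < 1 → ∀ r : ℕ, (0 : ℝ) < (N + r : ℕ) →
      Real.Gamma (γ * (N + r : ℕ) + 1) / Real.Gamma (γ * (N + (r + 1) : ℕ) + 1) ≤
        ((N + r : ℕ) : ℝ) ^ (-γ) * G γ r := by
    intro γ hγ r hr
    have hy : 0 < γ * (N + r : ℕ) + 1 := by have := hγ.1; positivity
    have e : γ * (N + (r + 1) : ℕ) + 1 = γ * (N + r : ℕ) + 1 + γ := by push_cast; ring
    have hw := Real.mul_Gamma_le_rpow_mul_Gamma_add hy hγ.1 hγ.2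
    have hΓ := Real.Gamma_pos_of_pos (show 0 < γ * (N + r : ℕ) + 1 + γ by linarith [hγ.1])
    rw [e, div_le_iff₀ hΓ]
    simp only [hG]
    rw [Real.div_rpow (by linarith [hγ.1]) hr.le, Real.rpow_sub hr, Real.rpow_one, Real.rpow_neg hr.le]
    have hp : (0 : ℝ) < ((N + r : ℕ) : ℝ) ^ γ := by positivity
    rw [← le_div_iff₀' hy] at hw
    refine hw.trans_eq ?_
    field_simp
  -- the limit of the bound for the quotients of consecutive terms
  obtain ⟨l, hl1, hl⟩ : ∃ l : ℝ, l < 1 ∧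
      Tendsto (fun r : ℕ => ((N + r : ℕ) : ℝ) ^ (1 - α - β) * (α ^ (-α) * β ^ (-β) * |x|)) atTop
        (𝓝 l) := by
    rcases h with h | ⟨h, hx'⟩ | h
    · refine ⟨0, one_pos, ?_⟩
      have := ((tendsto_rpow_neg_atTop (show 0 < α + β - 1 by linarith)).comp hM).mul_const
        (α ^ (-α) * β ^ (-β) * |x|)
      rw [zero_mul] at this
      refine this.congr fun r => ?_
      simp only [Function.comp_apply]
      congr 2
      ring
    · have hα0 := hα.1
      have hβ0 := hβ.1
      refine ⟨α ^ (-α) * β ^ (-β) * |x|, ?_, ?_⟩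
      · rw [Real.rpow_neg hα0.le, Real.rpow_neg hβ0.le, ← mul_inv, inv_mul_lt_iff₀ (by positivity),
          mul_one]
        exact hx'
      · rw [show 1 - α - β = 0 by linarith]
        simp
    · exact absurd h hx
  -- This sequence bounds the ratios of consecutive terms; the last factor, from the factorials,
  -- tends to `1`.
  have hbd : Tendsto (fun r : ℕ => ((N + r : ℕ) : ℝ) ^ (1 - α - β) * (G α r * G β r * |x|) *
      ((((1 * (N + r : ℕ) + 1) / (N + r : ℕ)) ^ 2) * (((N + r : ℕ) : ℝ) / ((r : ℝ) + 1)))) atTop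
        (𝓝 l) := by
    have hr1 : Tendsto (fun r : ℕ => ((N + r : ℕ) : ℝ) / ((r : ℝ) + 1)) atTop (𝓝 1) := by
      have := (tendsto_one_div_add_atTop_nhds_zero_nat (𝕜 := ℝ)).const_mul ((N : ℝ) - 1)
      have := this.const_add 1
      rw [mul_zero, add_zero] at this
      refine this.congr fun r => ?_
      push_cast
      field_simp
      ring
    have h1 := ((hlin 1 1).pow 2).mul hr1
    have hα0 := hα.1
    have hβ0 := hβ.1
    have hc : α ^ (-α) * β ^ (-β) * |x| ≠ 0 := by positivity
    have h2 := (((hGlim α hα.1).mul (hGlim β hβ.1)).mul_const |x|).div_const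
      (α ^ (-α) * β ^ (-β) * |x|)
    have h3 := (hl.mul h2).mul h1
    rw [div_self hc, mul_one, one_pow, mul_one, mul_one] at h3
    refine h3.congr fun r => ?_
    field_simp
  obtain ⟨ρ, hlρ, hρ1⟩ := exists_between hl1
  refine summable_of_ratio_norm_eventually_le hρ1 ?_
  filter_upwards [hbd.eventually_lt_const hlρ, hMpos] with r hr hMr
  have hα0 := hα.1
  have hβ0 := hβ.1
  have ha := hGbound α hα r hMr
  have hb := hGbound β hβ r hMr
  have p1 := Real.Gamma_pos_of_pos (show 0 < α * (N + r : ℕ) + 1 by positivity)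
  have p2 := Real.Gamma_pos_of_pos (show 0 < β * (N + r : ℕ) + 1 by positivity)
  have p3 := Real.Gamma_pos_of_pos (show 0 < α * (N + (r + 1) : ℕ) + 1 by positivity)
  have p4 := Real.Gamma_pos_of_pos (show 0 < β * (N + (r + 1) : ℕ) + 1 by positivity)
  have hab := mul_le_mul ha hb (by positivity) ((div_pos p1 p3).le.trans ha)
  rw [wrightTerm_upperParams_lowerParams, wrightTerm_upperParams_lowerParams]
  have hM2 : (((N + (r + 1))! : ℕ) : ℝ) = ((N + r : ℕ) + 1) * (N + r)! := by
    rw [← add_assoc, Nat.factorial_succ]; push_cast; ring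
  have hr2 : ((r + 1)! : ℝ) = (r + 1) * r ! := by rw [Nat.factorial_succ]; push_cast; ring
  rw [hM2, hr2]
  simp only [norm_mul, norm_div, norm_pow, Real.norm_eq_abs, abs_of_pos p1, abs_of_pos p2,
    abs_of_pos p3, abs_of_pos p4]
  set M : ℝ := ((N + r : ℕ) : ℝ) with hMdef
  set A := Real.Gamma (α * M + 1)
  set B := Real.Gamma (β * M + 1)
  set A' := Real.Gamma (α * (N + (r + 1) : ℕ) + 1)
  set B' := Real.Gamma (β * (N + (r + 1) : ℕ) + 1)
  have e3 : M ^ (1 - α - β) * M = M ^ 2 * (M ^ (-α) * M ^ (-β)) := by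
    rw [← Real.rpow_add hMr, ← Real.rpow_natCast, ← Real.rpow_add hMr, ← Real.rpow_add_one hMr.ne']
    congr 1
    push_cast
    ring
  rw [abs_of_pos (show 0 < M + 1 by positivity), abs_of_pos (show (0 : ℝ) < (r : ℝ) + 1 by positivity),
    abs_of_pos (show (0 : ℝ) < (N + r)! by positivity), abs_of_pos (show (0 : ℝ) < (r !) by positivity)]
  have e4 : ((M + 1) * ((N + r)! : ℝ)) ^ 2 / (A' * B' * ((r + 1) * r !)) * |x| ^ (r + 1) =
      (A / A' * (B / B')) * ((M + 1) ^ 2 / (r + 1) * |x|) *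
        (((N + r)! : ℝ) ^ 2 / (A * B * r !) * |x| ^ r) := by
    field_simp
    exact pow_succ' _ _
  rw [e4]
  refine mul_le_mul_of_nonneg_right ?_ (by positivity)
  refine (mul_le_mul_of_nonneg_right hab (by positivity)).trans (le_trans (le_of_eq ?_) hr.le)
  have e5 : M ^ (1 - α - β) = M * (M ^ (-α) * M ^ (-β)) := by
    apply mul_right_cancel₀ hMr.ne'
    rw [e3]; ring
  rw [e5, one_mul]
  field_simp

/-! ### Moments of the random area -/

section SubordinatedMoments

variable {Ω : Type*} [MeasurableSpace Ω] {P : Measure Ω} [IsProbabilityMeasure P] {α β : ℝ}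
  {L L' : ℝ≥0 → Ω → ℝ≥0} {s t : ℝ≥0}

theorem integrable_mul_pow (hα : 0 < α) (hβ : 0 < β) (hL : IsInverseStableSubordinator P α L)
    (hL' : IsInverseStableSubordinator P β L') (hind : IndepFun (L s) (L' t) P) (M : ℕ) :
    Integrable (fun ω => ((L s ω : ℝ) * L' t ω) ^ M) P := by
  simp_rw [mul_pow]
  exact (hind.comp (measurable_coe_nnreal_real.pow_const M)
    (measurable_coe_nnreal_real.pow_const M)).integrable_mul (hL.integrable_pow hα s M)
      (hL'.integrable_pow hβ t M)

theorem integral_mul_pow (hα : 0 < α) (hβ : 0 < β) (hL : IsInverseStableSubordinator P α L)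
    (hL' : IsInverseStableSubordinator P β L') (hind : IndepFun (L s) (L' t) P) (M : ℕ) :
    ∫ ω, ((L s ω : ℝ) * L' t ω) ^ M ∂P =
      (M ! : ℝ) ^ 2 * ((s : ℝ) ^ α * (t : ℝ) ^ β) ^ M /
        (Real.Gamma (α * M + 1) * Real.Gamma (β * M + 1)) := by
  simp_rw [mul_pow]
  have h := (hind.comp (measurable_coe_nnreal_real.pow_const M)
    (measurable_coe_nnreal_real.pow_const M)).integral_fun_mul_eq_mul_integral
      (hL.integrable_pow hα s M).1 (hL'.integrable_pow hβ t M).1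
  simp only [Function.comp_apply] at h
  rw [h, hL.integral_pow hα, hL'.integral_pow hβ]
  field_simp

/-- Exponentially tilted moments of `L s * L' t` in terms of the generalized Wright function. -/
theorem integral_mul_pow_mul_exp (hα : 0 < α) (hβ : 0 < β)
    (hL : IsInverseStableSubordinator P α L) (hL' : IsInverseStableSubordinator P β L')
    (hind : IndepFun (L s) (L' t) P) (N : ℕ) (c : ℝ)
    (hsum : Summable (wrightTerm (upperParams N) (lowerParams α β N)
      (c * (s : ℝ) ^ α * (t : ℝ) ^ β))) :
    ∫ ω, ((L s ω : ℝ) * L' t ω) ^ N * Real.exp (c * ((L s ω : ℝ) * L' t ω)) ∂P =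
      ((s : ℝ) ^ α * (t : ℝ) ^ β) ^ N * generalizedWright (upperParams N) (lowerParams α β N)
        (c * (s : ℝ) ^ α * (t : ℝ) ^ β) := by
  set F : ℕ → Ω → ℝ := fun r ω => c ^ r / (r ! : ℝ) * ((L s ω : ℝ) * L' t ω) ^ (N + r) with hF
  have hFi : ∀ r, Integrable (F r) P := fun r =>
    (integrable_mul_pow hα hβ hL hL' hind (N + r)).const_mul _
  have hFt : ∀ r, ∫ ω, F r ω ∂P = ((s : ℝ) ^ α * (t : ℝ) ^ β) ^ N *
      wrightTerm (upperParams N) (lowerParams α β N) (c * (s : ℝ) ^ α * (t : ℝ) ^ β) r := by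
    intro r
    simp only [hF]
    rw [integral_const_mul, integral_mul_pow hα hβ hL hL' hind,
      wrightTerm_upperParams_lowerParams, pow_add]
    have := Real.Gamma_pos_of_pos (show 0 < α * (N + r : ℕ) + 1 by positivity)
    have := Real.Gamma_pos_of_pos (show 0 < β * (N + r : ℕ) + 1 by positivity)
    field_simp
    rw [mul_pow _ c]
    ring
  -- For fixed `r` the sign of `F r ω` does not depend on `ω`, so absolute convergence of the Wright
  -- series is exactly summability of the `L¹` norms.
  have hFn : ∀ r, ∫ ω, ‖F r ω‖ ∂P = |∫ ω, F r ω ∂P| := by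
    intro r
    have h1 : ∀ ω, ‖F r ω‖ = |c ^ r / (r ! : ℝ)| * ((L s ω : ℝ) * L' t ω) ^ (N + r) := by
      intro ω
      rw [hF, norm_mul, Real.norm_eq_abs, Real.norm_eq_abs,
        abs_of_nonneg (by positivity : (0 : ℝ) ≤ ((L s ω : ℝ) * L' t ω) ^ (N + r))]
    simp_rw [h1]
    simp only [hF]
    rw [integral_const_mul, integral_const_mul, abs_mul,
      abs_of_nonneg (integral_nonneg fun ω => by positivity)]
  have hs : Summable fun r => ∫ ω, ‖F r ω‖ ∂P := by
    simp_rw [hFn, hFt]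
    exact (hsum.mul_left _).abs
  have hsumF : ∀ ω, ∑' r, F r ω =
      ((L s ω : ℝ) * L' t ω) ^ N * Real.exp (c * ((L s ω : ℝ) * L' t ω)) := by
    intro ω
    have h1 := NormedSpace.expSeries_div_hasSum_exp (c * ((L s ω : ℝ) * L' t ω))
    rw [← Real.exp_eq_exp_ℝ] at h1
    rw [← (h1.mul_left _).tsum_eq]
    refine tsum_congr fun r => ?_
    simp only [hF]
    rw [mul_pow c, pow_add]
    ring
  have h := hasSum_integral_of_summable_integral_norm hFi hs
  simp_rw [hsumF, hFt] at h
  rw [generalizedWright, ← tsum_mul_left]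
  exact h.tsum_eq.symm

theorem lintegral_mul_pow_mul_exp (hα : 0 < α) (hβ : 0 < β)
    (hL : IsInverseStableSubordinator P α L) (hL' : IsInverseStableSubordinator P β L')
    (hind : IndepFun (L s) (L' t) P) (N : ℕ) {c : ℝ} (hc : c ≤ 0)
    (hsum : Summable (wrightTerm (upperParams N) (lowerParams α β N)
      (c * (s : ℝ) ^ α * (t : ℝ) ^ β))) :
    ∫⁻ ω, ENNReal.ofReal
        (((L s ω : ℝ) * L' t ω) ^ N * Real.exp (c * ((L s ω : ℝ) * L' t ω))) ∂P =
      ENNReal.ofReal (((s : ℝ) ^ α * (t : ℝ) ^ β) ^ N *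
        generalizedWright (upperParams N) (lowerParams α β N) (c * (s : ℝ) ^ α * (t : ℝ) ^ β)) := by
  have hm := hL.1 s
  have hm' := hL'.1 t
  rw [← integral_mul_pow_mul_exp hα hβ hL hL' hind N c hsum,
    ofReal_integral_eq_lintegral_ofReal _ (.of_forall fun ω => by positivity)]
  refine (integrable_mul_pow hα hβ hL hL' hind N).mono' (by fun_prop) (.of_forall fun ω => ?_)
  rw [Real.norm_eq_abs, abs_of_nonneg (by positivity)]
  refine mul_le_of_le_one_right (by positivity) (Real.exp_le_one_iff.2 ?_)
  exact mul_nonpos_of_nonpos_of_nonneg hc (by positivity)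

/-- The sign is invisible in an alternating series, but the product is an expectation of a
nonnegative variable. -/
theorem generalizedWright_nonneg (hα : 0 < α) (hβ : 0 < β)
    (hL : IsInverseStableSubordinator P α L) (hL' : IsInverseStableSubordinator P β L')
    (hind : IndepFun (L s) (L' t) P) (N : ℕ) (c : ℝ)
    (hsum : Summable (wrightTerm (upperParams N) (lowerParams α β N)
      (c * (s : ℝ) ^ α * (t : ℝ) ^ β))) :
    0 ≤ ((s : ℝ) ^ α * (t : ℝ) ^ β) ^ N *
      generalizedWright (upperParams N) (lowerParams α β N) (c * (s : ℝ) ^ α * (t : ℝ) ^ β) := by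
  rw [← integral_mul_pow_mul_exp hα hβ hL hL' hind N c hsum]
  exact integral_nonneg fun ω => by positivity

end SubordinatedMoments

/-! ### One-point laws of the Poisson and Skellam fields -/

/-- The weight `∑ j v_j` of a vector `(v₁, …, v_k)` of multiplicities. -/
def jumpSum {k : ℕ} (v : Fin k → ℕ) : ℕ := ∑ j : Fin k, ((j : ℕ) + 1) * v j

/-- The probability of `(v₁, …, v_k)` under the product of the Poisson laws with means
`lam j * a`. -/
noncomputable def poissonWeight {k : ℕ} (lam : Fin k → ℝ) (a : ℝ) (v : Fin k → ℕ) : ℝ :=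
  ∏ j, (lam j * a) ^ v j / ((v j)! : ℝ) * Real.exp (-(lam j * a))

theorem poissonWeight_nonneg {k : ℕ} {lam : Fin k → ℝ} (hlam : ∀ j, 0 < lam j) {a : ℝ}
    (ha : 0 ≤ a) (v : Fin k → ℕ) : 0 ≤ poissonWeight lam a v := by
  refine Finset.prod_nonneg fun j _ => ?_
  have := hlam j
  positivity

theorem poissonWeight_zero {k : ℕ} (lam : Fin k → ℝ) (v : Fin k → ℕ) :
    poissonWeight lam 0 v = if v = 0 then 1 else 0 := by
  split_ifs with h
  · simp [poissonWeight, h]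
  · obtain ⟨j, hj⟩ := Function.ne_iff.1 h
    refine Finset.prod_eq_zero (Finset.mem_univ j) ?_
    simp only [Pi.zero_apply] at hj
    simp [hj]

section

variable {Ω : Type*} [MeasurableSpace Ω] {P : Measure Ω} {k : ℕ}

/-- The one-point laws of a generalized Poisson random field. -/
theorem IsGPRF.measureReal_eq [IsProbabilityMeasure P] {lam : Fin k → ℝ} {M : Quadrant → Ω → ℕ} (hM : IsGPRF P lam M)
    (p : Quadrant) (n : ℕ) :
    P.real {ω | M p ω = n} = ∑ v ∈ thetaNat k n, poissonWeight lam ((p.1 : ℝ) * p.2) v := by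
  by_cases hp : 0 < p.1 ∧ 0 < p.2
  · have h := hM.increment_law (0, 0) p hp.1 hp.2 n
    simp only [NNReal.coe_zero, sub_zero] at h
    rw [← show _ = ∑ v ∈ thetaNat k n, poissonWeight lam ((p.1 : ℝ) * p.2) v from h]
    refine measureReal_congr ?_
    filter_upwards [hM.zero_left p.2, hM.zero_right p.1, hM.zero_left 0] with ω h1 h2 h3
    refine propext ?_
    show M p ω = n ↔ rectIncrement (fun x ω => (M x ω : ℤ)) (0, 0) p ω = n
    simp only [rectIncrement, h1, h2, h3]
    push_cast
    omega
  -- On the axes the increment law says nothing; there both sides are the point mass at `0`.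
  · have hp0 : (p.1 : ℝ) * p.2 = 0 := by
      simp only [not_and_or, not_lt, nonpos_iff_eq_zero] at hp
      rcases hp with hp | hp <;> simp [hp]
    have hM0 : ∀ᵐ ω ∂P, M p ω = 0 := by
      simp only [not_and_or, not_lt, nonpos_iff_eq_zero] at hp
      rcases hp with hp | hp
      · rw [show p = (0, p.2) from Prod.ext hp rfl]
        exact hM.zero_left _
      · rw [show p = (p.1, 0) from Prod.ext rfl hp]
        exact hM.zero_right _
    rw [hp0]
    simp_rw [poissonWeight_zero]
    rw [Finset.sum_ite_eq']
    have h0 : (0 : Fin k → ℕ) ∈ thetaNat k n ↔ 0 = n := by simp [mem_thetaNat]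
    have hset : P.real {ω | M p ω = n} = P.real {_ω : Ω | 0 = n} := by
      refine measureReal_congr ?_
      filter_upwards [hM0] with ω hω
      refine propext ?_
      show M p ω = n ↔ 0 = n
      rw [hω]
    rw [hset]
    by_cases hn : 0 = n
    · simp [h0, hn]
    · simp [h0, hn]

theorem IsGPRF.measure_eq_tsum [IsProbabilityMeasure P] {lam : Fin k → ℝ} {M : Quadrant → Ω → ℕ} (hM : IsGPRF P lam M)
    (p : Quadrant) (n : ℕ) :
    P {ω | M p ω = n} = ∑' v : Fin k → ℕ, if jumpSum v = n then
      ENNReal.ofReal (poissonWeight lam ((p.1 : ℝ) * p.2) v) else 0 := by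
  rw [← ofReal_measureReal, hM.measureReal_eq, ENNReal.ofReal_sum_of_nonneg
    fun v _ => poissonWeight_nonneg hM.rate_pos (by positivity) v,
    tsum_eq_sum (s := thetaNat k n)]
  · refine Finset.sum_congr rfl fun v hv => ?_
    rw [if_pos (show jumpSum v = n from (mem_thetaNat v).1 hv)]
  · intro v hv
    rw [if_neg fun h : jumpSum v = n => hv ((mem_thetaNat v).2 h)]

/-- The law of the difference of two independent counting variables, each being the weight of a
random vector. -/
theorem measure_sub_eq_tsum {ι κ : Type*} {X Y : Ω → ℕ} (hX : Measurable X)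
    (hY : Measurable Y) (hXY : IndepFun X Y P) (f : ι → ℕ) (g : κ → ℕ) (a : ι → ENNReal)
    (b : κ → ENNReal) (ha : ∀ n, P {ω | X ω = n} = ∑' v, if f v = n then a v else 0)
    (hb : ∀ n, P {ω | Y ω = n} = ∑' w, if g w = n then b w else 0) (n : ℤ) :
    P {ω | (X ω : ℤ) - Y ω = n} =
      ∑' q : ι × κ, if (f q.1 : ℤ) - g q.2 = n then a q.1 * b q.2 else 0 := by
  have hm : Measurable fun ω => (X ω, Y ω) := hX.prodMk hY
  set T : Set (ℕ × ℕ) := {x | (x.1 : ℤ) - x.2 = n} with hT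
  have h1 : P {ω | (X ω : ℤ) - Y ω = n} = ∑' x : ℕ × ℕ,
      T.indicator 1 x * (P {ω | X ω = x.1} * P {ω | Y ω = x.2}) := by
    have : {ω | (X ω : ℤ) - Y ω = n} = (fun ω => (X ω, Y ω)) ⁻¹' T := rfl
    rw [this, ← Measure.map_apply hm (Set.to_countable _).measurableSet,
      ← lintegral_indicator_one (Set.to_countable _).measurableSet, lintegral_countable']
    refine tsum_congr fun x => ?_
    congr 1
    rw [Measure.map_apply hm (measurableSet_singleton _)]
    have e : (fun ω => (X ω, Y ω)) ⁻¹' {x} = X ⁻¹' {x.1} ∩ Y ⁻¹' {x.2} := by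
      ext ω
      simp [Prod.ext_iff]
    rw [e, hXY.measure_inter_preimage_eq_mul _ _ (measurableSet_singleton _)
      (measurableSet_singleton _)]
    rfl
  have h2 : ∀ x : ℕ × ℕ, T.indicator 1 x * (P {ω | X ω = x.1} * P {ω | Y ω = x.2}) =
      ∑' q : ι × κ, T.indicator 1 x * (if (f q.1, g q.2) = x then a q.1 * b q.2 else 0) := by
    intro x
    rw [ENNReal.tsum_mul_left, ha, hb, ENNReal.tsum_prod', ← ENNReal.tsum_mul_right]
    congr 1
    refine tsum_congr fun v => ?_
    rw [← ENNReal.tsum_mul_left]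
    refine tsum_congr fun w => ?_
    by_cases h : f v = x.1 <;> by_cases h' : g w = x.2 <;> simp [Prod.ext_iff, h, h']
  rw [h1]
  simp_rw [h2]
  rw [ENNReal.tsum_comm]
  refine tsum_congr fun q => ?_
  rw [tsum_eq_single (f q.1, g q.2) fun x hx => by rw [if_neg hx.symm, mul_zero]]
  simp [hT, Set.indicator_apply]

end

/-- A pair of multiplicity vectors corresponds to its difference and its pointwise minimum. -/
def subMinEquiv (ι : Type*) : (ι → ℕ) × (ι → ℕ) ≃ (ι → ℤ) × (ι → ℕ) where
  toFun q := (fun j => (q.1 j : ℤ) - q.2 j, fun j => min (q.1 j) (q.2 j))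
  invFun q := (fun j => q.2 j + (q.1 j).toNat, fun j => q.2 j + (-q.1 j).toNat)
  left_inv q := by
    refine Prod.ext (funext fun j => ?_) (funext fun j => ?_) <;> simp only <;> omega
  right_inv q := by
    refine Prod.ext (funext fun j => ?_) (funext fun j => ?_) <;> simp only <;> omega

/-- The coefficient of `a ^ N * exp (-Λ a)` contributed by difference `u` and minimum `m`. -/
noncomputable def skellamCoeff {k : ℕ} (lam₁ lam₂ : Fin k → ℝ) (u : Fin k → ℤ)
    (m : Fin k → ℕ) : ℝ :=
  (∏ j, (lam₁ j / lam₂ j) ^ ((u j : ℝ) / 2)) *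
    ∏ j, √(lam₁ j * lam₂ j) ^ (2 * m j + (u j).natAbs) /
      ((((u j).natAbs + m j)! : ℝ) * ((m j)! : ℝ))

/-- One coordinate of the change of variables: one exponent is `m + |d|` and the other is `m`, so
the sum is `2 m + |d|` and the imbalance becomes `(l / l') ^ (d / 2)`. -/
theorem pow_div_factorial_mul_pow_div_factorial {l l' : ℝ} (hl : 0 < l) (hl' : 0 < l') (a : ℝ)
    (d : ℤ) (m : ℕ) :
    (l * a) ^ (m + d.toNat) / ((m + d.toNat)! : ℝ) *
        ((l' * a) ^ (m + (-d).toNat) / ((m + (-d).toNat)! : ℝ)) =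
      (l / l') ^ ((d : ℝ) / 2) * (√(l * l') ^ (2 * m + d.natAbs) /
        (((d.natAbs + m)! : ℝ) * (m ! : ℝ))) * a ^ (2 * m + d.natAbs) := by
  have hs : 0 < √l := Real.sqrt_pos.2 hl
  have hs' : 0 < √l' := Real.sqrt_pos.2 hl'
  have e1 : l = √l ^ 2 := (Real.sq_sqrt hl.le).symm
  have e2 : l' = √l' ^ 2 := (Real.sq_sqrt hl'.le).symm
  have e3 : √(l * l') = √l * √l' := Real.sqrt_mul hl.le _
  have e4 : ∀ x : ℝ, (l / l') ^ (x / 2) = (√l / √l') ^ x := by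
    intro x
    have : l / l' = (√l / √l') ^ (2 : ℝ) := by
      rw [Real.rpow_two, div_pow, ← e1, ← e2]
    rw [this, ← Real.rpow_mul (by positivity)]
    congr 1
    ring
  rw [e4, e3]
  -- With `l = x ^ 2` and `l' = y ^ 2` the claim becomes an identity of rational functions for each
  -- sign of `d`.
  generalize √l = x at *
  generalize √l' = y at *
  subst e1 e2
  obtain ⟨n, rfl | rfl⟩ := d.eq_nat_or_neg
  · simp only [Int.toNat_natCast, Int.toNat_neg_natCast, Int.natAbs_natCast, Int.cast_natCast,
      Real.rpow_natCast, div_pow, add_zero, add_comm n m]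
    field_simp
    ring
  · simp only [Int.toNat_natCast, Int.toNat_neg_natCast, Int.natAbs_neg, Int.natAbs_natCast,
      Int.cast_natCast, Int.cast_neg, neg_neg, Real.rpow_neg (div_pos hs hs').le,
      Real.rpow_natCast, div_pow, add_zero, add_comm n m]
    field_simp
    ring

theorem poissonWeight_mul_poissonWeight {k : ℕ} {lam₁ lam₂ : Fin k → ℝ} (h₁ : ∀ j, 0 < lam₁ j)
    (h₂ : ∀ j, 0 < lam₂ j) (a : ℝ) (q : (Fin k → ℤ) × (Fin k → ℕ)) :
    poissonWeight lam₁ a ((subMinEquiv _).symm q).1 *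
        poissonWeight lam₂ a ((subMinEquiv _).symm q).2 =
      skellamCoeff lam₁ lam₂ q.1 q.2 * (a ^ (∑ j, (2 * q.2 j + (q.1 j).natAbs)) *
        Real.exp (-(∑ j, lam₁ j + ∑ j, lam₂ j) * a)) := by
  have e : Real.exp (-(∑ j, lam₁ j + ∑ j, lam₂ j) * a) =
      ∏ j, Real.exp (-(lam₁ j * a)) * Real.exp (-(lam₂ j * a)) := by
    simp_rw [← Real.exp_add, ← Real.exp_sum]
    congr 1
    rw [Finset.sum_add_distrib, Finset.sum_neg_distrib, Finset.sum_neg_distrib, ← Finset.sum_mul,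
      ← Finset.sum_mul]
    ring
  rw [e, ← Finset.prod_pow_eq_pow_sum]
  simp only [poissonWeight, skellamCoeff, ← Finset.prod_mul_distrib]
  refine Finset.prod_congr rfl fun j _ => ?_
  have := pow_div_factorial_mul_pow_div_factorial (h₁ j) (h₂ j) a (q.1 j) (q.2 j)
  simp only [subMinEquiv, Equiv.coe_fn_symm_mk]
  linear_combination Real.exp (-(lam₁ j * a)) * Real.exp (-(lam₂ j * a)) * this

theorem jumpSum_sub_jumpSum {k : ℕ} (q : (Fin k → ℤ) × (Fin k → ℕ)) :
    (jumpSum ((subMinEquiv _).symm q).1 : ℤ) - jumpSum ((subMinEquiv _).symm q).2 =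
      ∑ j : Fin k, (((j : ℕ) : ℤ) + 1) * q.1 j := by
  simp only [jumpSum, subMinEquiv, Equiv.coe_fn_symm_mk]
  push_cast
  rw [← Finset.sum_sub_distrib]
  refine Finset.sum_congr rfl fun j _ => ?_
  rw [← mul_sub]
  congr 1
  omega

/-- The one-point laws of the generalized Skellam point process. -/
theorem IsGSPP.measure_eq_tsum {Ω : Type*} [MeasurableSpace Ω] {P : Measure Ω}
    [IsProbabilityMeasure P] {k : ℕ} {lam₁ lam₂ : Fin k → ℝ} {S : Quadrant → Ω → ℤ}
    (hS : IsGSPP P lam₁ lam₂ S) (p : Quadrant) (n : ℤ) :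
    P {ω | S p ω = n} = ∑' (u : thetaInt k n) (m : Fin k → ℕ),
      ENNReal.ofReal (skellamCoeff lam₁ lam₂ u m *
        (((p.1 : ℝ) * p.2) ^ (∑ j, (2 * m j + ((u : Fin k → ℤ) j).natAbs)) *
          Real.exp (-(∑ j, lam₁ j + ∑ j, lam₂ j) * ((p.1 : ℝ) * p.2)))) := by
  obtain ⟨M₁, M₂, h₁, h₂, hind, hdiff⟩ := hS
  have hI : IndepFun (M₁ p) (M₂ p) P :=
    indep_of_indep_of_le_left (indep_of_indep_of_le_right hind
      (le_iSup (fun i => MeasurableSpace.comap (M₂ i) inferInstance) p))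
      (le_iSup (fun i => MeasurableSpace.comap (M₁ i) inferInstance) p)
  simp_rw [hdiff p]
  rw [measure_sub_eq_tsum (h₁.measurable p) (h₂.measurable p) hI jumpSum jumpSum _ _
    (h₁.measure_eq_tsum p) (h₂.measure_eq_tsum p) n, ← (subMinEquiv (Fin k)).symm.tsum_eq]
  simp_rw [jumpSum_sub_jumpSum]
  rw [ENNReal.tsum_prod', tsum_subtype (thetaInt k n) fun u => ∑' m : Fin k → ℕ,
      ENNReal.ofReal (skellamCoeff lam₁ lam₂ u m *
        (((p.1 : ℝ) * p.2) ^ (∑ j, (2 * m j + (u j).natAbs)) *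
          Real.exp (-(∑ j, lam₁ j + ∑ j, lam₂ j) * ((p.1 : ℝ) * p.2))))]
  refine tsum_congr fun u => ?_
  by_cases hu : u ∈ thetaInt k n
  · rw [Set.indicator_of_mem hu]
    refine tsum_congr fun m => ?_
    rw [if_pos (show ∑ j : Fin k, (((j : ℕ) : ℤ) + 1) * u j = n from hu), ← ENNReal.ofReal_mul
      (poissonWeight_nonneg h₁.rate_pos (by positivity) _),
      poissonWeight_mul_poissonWeight h₁.rate_pos h₂.rate_pos]
  · rw [Set.indicator_of_notMem hu]
    simp only [show ¬ ∑ j : Fin k, (((j : ℕ) : ℤ) + 1) * u j = n from hu, if_false, tsum_zero]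

/-! ### Evaluation at independent random times -/

section RandomEvaluation

open Filter Topology

/-- The upper grid point `⌈(n + 1) x⌉ / (n + 1)`. -/
noncomputable def gridUp (n : ℕ) (x : ℝ≥0) : ℝ≥0 := (⌈((n : ℝ≥0) + 1) * x⌉₊ : ℝ≥0) / ((n : ℝ≥0) + 1)

theorem le_gridUp (n : ℕ) (x : ℝ≥0) : x ≤ gridUp n x := by
  rw [gridUp, le_div_iff₀ (by positivity), mul_comm]
  exact Nat.le_ceil _

theorem tendsto_gridUp (x : ℝ≥0) : Tendsto (fun n => gridUp n x) atTop (𝓝 x) := by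
  have h : Tendsto (fun n : ℕ => x + 1 / ((n : ℝ≥0) + 1)) atTop (𝓝 x) := by
    simpa using (tendsto_one_div_add_atTop_nhds_zero_nat (𝕜 := ℝ≥0)).const_add x
  refine tendsto_of_tendsto_of_tendsto_of_le_of_le tendsto_const_nhds h (fun n => le_gridUp n x)
    fun n => ?_
  have h1 : (⌈((n : ℝ≥0) + 1) * x⌉₊ : ℝ≥0) ≤ ((n : ℝ≥0) + 1) * x + 1 :=
    (Nat.ceil_lt_add_one (by positivity)).le
  show gridUp n x ≤ x + 1 / ((n : ℝ≥0) + 1)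
  have h2 : (x + 1 / ((n : ℝ≥0) + 1)) * ((n : ℝ≥0) + 1) = ((n : ℝ≥0) + 1) * x + 1 := by
    field_simp
  rw [gridUp, div_le_iff₀ (by positivity), h2]
  exact h1

/-- The values of a two-parameter process on the grids of mesh `1 / (n + 1)`. -/
noncomputable def gridValues {Ω : Type*} (S : Quadrant → Ω → ℤ) (ω : Ω) (i : ℕ × ℕ × ℕ) : ℤ :=
  S ((i.2.1 : ℝ≥0) / ((i.1 : ℝ≥0) + 1), (i.2.2 : ℝ≥0) / ((i.1 : ℝ≥0) + 1)) ω

/-- The set of points and grid values such that the values at the grid points approaching the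
point from the upper right are eventually `m`. -/
def gridLimitSet (m : ℤ) : Set ((ℝ≥0 × ℝ≥0) × (ℕ × ℕ × ℕ → ℤ)) :=
  {x | ∀ᶠ n : ℕ in atTop,
    x.2 (n, ⌈((n : ℝ≥0) + 1) * x.1.1⌉₊, ⌈((n : ℝ≥0) + 1) * x.1.2⌉₊) = m}

theorem measurable_grid_eval (n : ℕ) :
    Measurable fun x : (ℝ≥0 × ℝ≥0) × (ℕ × ℕ × ℕ → ℤ) =>
      x.2 (n, ⌈((n : ℝ≥0) + 1) * x.1.1⌉₊, ⌈((n : ℝ≥0) + 1) * x.1.2⌉₊) := by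
  have h1 : Measurable fun y : (ℕ × ℕ × ℕ → ℤ) × (ℕ × ℕ × ℕ) => y.1 y.2 :=
    measurable_from_prod_countable_left fun i => measurable_pi_apply i
  refine h1.comp (measurable_snd.prodMk (measurable_const.prodMk (Measurable.prodMk ?_ ?_)))
  · exact Nat.measurable_ceil.comp (by fun_prop)
  · exact Nat.measurable_ceil.comp (by fun_prop)

theorem measurableSet_gridLimitSet (m : ℤ) : MeasurableSet (gridLimitSet m) := by
  simp only [gridLimitSet, eventually_atTop, Set.ofPred_exists, Set.ofPred_forall]
  exact .iUnion fun _ => .iInter fun n => .iInter fun _ =>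
    measurable_grid_eval n (measurableSet_singleton m)

variable {Ω : Type*} {S : Quadrant → Ω → ℤ}

theorem tendsto_gridValues {ω : Ω} (hω : ∀ p, ContinuousWithinAt (fun q => S q ω) (Set.Ici p) p)
    (p : Quadrant) :
    Tendsto (fun n : ℕ => gridValues S ω (n, ⌈((n : ℝ≥0) + 1) * p.1⌉₊, ⌈((n : ℝ≥0) + 1) * p.2⌉₊))
      atTop (𝓝 (S p ω)) := by
  have h : Tendsto (fun n : ℕ => (gridUp n p.1, gridUp n p.2)) atTop (𝓝[Set.Ici p] p) :=
    tendsto_nhdsWithin_iff.2 ⟨(tendsto_gridUp p.1).prodMk_nhds (tendsto_gridUp p.2),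
      .of_forall fun n => ⟨le_gridUp n p.1, le_gridUp n p.2⟩⟩
  exact (hω p).tendsto.comp h

theorem mem_gridLimitSet_iff {ω : Ω}
    (hω : ∀ p, ContinuousWithinAt (fun q => S q ω) (Set.Ici p) p) (p : Quadrant) (m : ℤ) :
    (p, gridValues S ω) ∈ gridLimitSet m ↔ S p ω = m := by
  -- In the discrete space `ℤ` convergence is eventual equality.
  have h := tendsto_gridValues hω p
  rw [nhds_discrete, tendsto_pure] at h
  constructor
  · intro hm
    obtain ⟨n, h1, h2⟩ := (h.and hm).exists
    exact h1.symm.trans h2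
  · rintro rfl
    exact h

variable [MeasurableSpace Ω] {P : Measure Ω}

theorem measurable_gridValues (hS : ∀ p, Measurable (S p)) : Measurable (gridValues S) :=
  measurable_pi_iff.2 fun _ => hS _

/-- The field is not assumed jointly measurable; its value at random times is an almost sure limit
of values on countable grids. -/
theorem aemeasurable_random_evaluation (hS : ∀ p, Measurable (S p))
    (hrc : ∀ᵐ ω ∂P, ∀ p, ContinuousWithinAt (fun q => S q ω) (Set.Ici p) p)
    {X Y : Ω → ℝ≥0} (hX : Measurable X) (hY : Measurable Y) :
    AEMeasurable (fun ω => S (X ω, Y ω) ω) P := by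
  refine aemeasurable_of_tendsto_metrizable_ae atTop
    (f := fun (n : ℕ) ω => gridValues S ω
      (n, ⌈((n : ℝ≥0) + 1) * X ω⌉₊, ⌈((n : ℝ≥0) + 1) * Y ω⌉₊)) (fun n => ?_) ?_
  · exact ((measurable_grid_eval n).comp
      ((hX.prodMk hY).prodMk (measurable_gridValues hS))).aemeasurable
  · filter_upwards [hrc] with ω hω using tendsto_gridValues hω (X ω, Y ω)

/-- Evaluation of a right-continuous process at independent random times: conditioning on the
times. -/
theorem measure_random_evaluation [IsProbabilityMeasure P] (hS : ∀ p, Measurable (S p))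
    (hrc : ∀ᵐ ω ∂P, ∀ p, ContinuousWithinAt (fun q => S q ω) (Set.Ici p) p)
    {X Y : Ω → ℝ≥0} (hX : Measurable X) (hY : Measurable Y)
    (hind : IndepFun (fun ω => (X ω, Y ω)) (gridValues S) P) (m : ℤ) (f : ℝ≥0 × ℝ≥0 → ENNReal)
    (hfm : Measurable f) (hf : ∀ p : Quadrant, P {ω | S p ω = m} = f p) :
    P {ω | S (X ω, Y ω) ω = m} = ∫⁻ ω, f (X ω, Y ω) ∂P := by
  have hXY : Measurable fun ω => (X ω, Y ω) := hX.prodMk hY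
  have hZ := measurable_gridValues hS
  -- Up to a null set the event is a measurable condition on the pair of times and the countable
  -- family of grid values, so Fubini applies to a product law.
  have h1 : P {ω | S (X ω, Y ω) ω = m} =
      P ((fun ω => ((X ω, Y ω), gridValues S ω)) ⁻¹' gridLimitSet m) := by
    refine measure_congr ?_
    filter_upwards [hrc] with ω hω
    exact propext (mem_gridLimitSet_iff hω (X ω, Y ω) m).symm
  rw [h1, ← Measure.map_apply (hXY.prodMk hZ) (measurableSet_gridLimitSet m),
    (indepFun_iff_map_prod_eq_prod_map_map hXY.aemeasurable hZ.aemeasurable).1 hind]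
  have := Measure.isProbabilityMeasure_map (μ := P) hZ.aemeasurable
  rw [Measure.prod_apply (measurableSet_gridLimitSet m), ← lintegral_map hfm hXY]
  refine lintegral_congr fun p => ?_
  rw [Measure.map_apply hZ (measurable_prodMk_left (measurableSet_gridLimitSet m)), ← hf p]
  refine measure_congr ?_
  filter_upwards [hrc] with ω hω
  exact propext (mem_gridLimitSet_iff hω p m)

end RandomEvaluation

/-! ### Assembly of the subordinated law -/

theorem hasSum_of_tsum_ofReal_eq {ι : Type*} {f : ι → ℝ} (hf : ∀ i, 0 ≤ f i) {a : ENNReal}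
    (ha : a ≠ ⊤) (h : ∑' i, ENNReal.ofReal (f i) = a) : HasSum f a.toReal := by
  have h1 := ENNReal.hasSum_toReal (h ▸ ha)
  rw [← ENNReal.tsum_toReal_eq fun i => ENNReal.ofReal_ne_top, h] at h1
  exact h1.congr_fun fun i => (ENNReal.toReal_ofReal (hf i)).symm

namespace IsGSPP

variable {Ω : Type*} [MeasurableSpace Ω] {P : Measure Ω} {k : ℕ} {lam₁ lam₂ : Fin k → ℝ}
  {S : Quadrant → Ω → ℤ}

theorem rate_pos (hS : IsGSPP P lam₁ lam₂ S) : (∀ j, 0 < lam₁ j) ∧ ∀ j, 0 < lam₂ j := by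
  obtain ⟨M₁, M₂, h₁, h₂, -⟩ := hS
  exact ⟨h₁.rate_pos, h₂.rate_pos⟩

theorem measurable (hS : IsGSPP P lam₁ lam₂ S) (p : Quadrant) : Measurable (S p) := by
  obtain ⟨M₁, M₂, h₁, h₂, -, h⟩ := hS
  have := h₁.measurable p
  have := h₂.measurable p
  rw [funext (h p)]
  fun_prop

theorem right_continuous (hS : IsGSPP P lam₁ lam₂ S) :
    ∀ᵐ ω ∂P, ∀ p, ContinuousWithinAt (fun q => S q ω) (Set.Ici p) p := by
  obtain ⟨M₁, M₂, h₁, h₂, -, h⟩ := hS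
  filter_upwards [h₁.right_continuous, h₂.right_continuous] with ω hω₁ hω₂ p
  simp_rw [h]
  have hc : Continuous fun n : ℕ => (n : ℤ) := continuous_of_discreteTopology
  exact (hc.continuousAt.comp_continuousWithinAt (hω₁ p)).sub
    (hc.continuousAt.comp_continuousWithinAt (hω₂ p))

end IsGSPP

theorem comap_le_generatedSigma {Ω ι E : Type*} [MeasurableSpace E] (X : ι → Ω → E) (i : ι) :
    MeasurableSpace.comap (X i) inferInstance ≤ generatedSigma X :=
  le_iSup (fun i => MeasurableSpace.comap (X i) inferInstance) i

theorem generatedSigma_le {Ω ι E : Type*} [MeasurableSpace Ω] [MeasurableSpace E] {X : ι → Ω → E}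
    (hX : ∀ i, Measurable (X i)) : generatedSigma X ≤ ‹MeasurableSpace Ω› :=
  iSup_le fun i => (hX i).comap_le

theorem skellamCoeff_mul_eq {k : ℕ} (lam₁ lam₂ : Fin k → ℝ) (α β s t : ℝ) (u : Fin k → ℤ)
    (m : Fin k → ℕ) :
    skellamCoeff lam₁ lam₂ u m * ((s ^ α * t ^ β) ^ (∑ j, (2 * m j + (u j).natAbs)) *
      generalizedWright (upperParams (∑ j, (2 * m j + (u j).natAbs)))
        (lowerParams α β (∑ j, (2 * m j + (u j).natAbs)))
        (-(∑ j, lam₁ j + ∑ j, lam₂ j) * s ^ α * t ^ β)) =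
      (∏ j, (lam₁ j / lam₂ j) ^ ((u j : ℝ) / 2)) * skellamTerm lam₁ lam₂ α β s t u m := by
  rw [skellamCoeff, skellamTerm, ← Finset.prod_pow_eq_pow_sum, mul_assoc, ← mul_assoc (∏ j, _ / _),
    ← Finset.prod_mul_distrib]
  congr 2
  refine Finset.prod_congr rfl fun j _ => ?_
  rw [mul_assoc √_, mul_pow √_]
  ring

theorem skellamCoeff_nonneg {k : ℕ} {lam₁ lam₂ : Fin k → ℝ} (h₁ : ∀ j, 0 < lam₁ j)
    (h₂ : ∀ j, 0 < lam₂ j) (u : Fin k → ℤ) (m : Fin k → ℕ) : 0 ≤ skellamCoeff lam₁ lam₂ u m := by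
  refine mul_nonneg (Finset.prod_nonneg fun j _ => ?_) (Finset.prod_nonneg fun j _ => by positivity)
  exact Real.rpow_nonneg (div_pos (h₁ j) (h₂ j)).le _

theorem mainTheorem11 {Ω : Type*} [MeasurableSpace Ω] (P : Measure Ω) [IsProbabilityMeasure P]
    (k : ℕ) (hk : 1 ≤ k) (lam₁ lam₂ : Fin k → ℝ)
    (α β : ℝ) (hα : 0 < α ∧ α < 1) (hβ : 0 < β ∧ β < 1)
    (S : Quadrant → Ω → ℤ) (hS : IsGSPP P lam₁ lam₂ S)
    (L L' : ℝ≥0 → Ω → ℝ≥0)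
    (hL : IsInverseStableSubordinator P α L) (hL' : IsInverseStableSubordinator P β L')
    (hindep : iIndep ![generatedSigma S, generatedSigma L, generatedSigma L'] P)
    (s t : ℝ≥0)
    -- the exact range of absolute convergence of the Wright series below
    (hconv : 1 < α + β ∨
      (α + β = 1 ∧ (∑ j, lam₁ j + ∑ j, lam₂ j) * (s : ℝ) ^ α * (t : ℝ) ^ β < α ^ α * β ^ β) ∨
      s = 0 ∨ t = 0) :
    AEMeasurable (fun ω => S (L s ω, L' t ω) ω) P ∧
    (∀ N : ℕ, Summable (wrightTerm (upperParams N) (lowerParams α β N)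
      (-(∑ j, lam₁ j + ∑ j, lam₂ j) * (s : ℝ) ^ α * (t : ℝ) ^ β))) ∧
    (∀ v : Fin k → ℤ, Summable fun m : Fin k → ℕ => skellamTerm lam₁ lam₂ α β s t v m) ∧
    ∀ n : ℤ,
      HasSum
        (fun v : thetaInt k n =>
          (∏ j, (lam₁ j / lam₂ j) ^ (((v : Fin k → ℤ) j : ℝ) / 2)) *
            ∑' m : Fin k → ℕ, skellamTerm lam₁ lam₂ α β s t v m)
        (P.real {ω | S (L s ω, L' t ω) ω = n}) := by
  obtain ⟨hr₁, hr₂⟩ := hS.rate_pos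
  have hΛ : 0 ≤ ∑ j, lam₁ j + ∑ j, lam₂ j :=
    add_nonneg (Finset.sum_nonneg fun j _ => (hr₁ j).le) (Finset.sum_nonneg fun j _ => (hr₂ j).le)
  have hX := hL.1 s
  have hY := hL'.1 t
  have hXY : IndepFun (L s) (L' t) P := by
    have h : Indep (generatedSigma L) (generatedSigma L') P :=
      hindep.indep (show (1 : Fin 3) ≠ 2 by decide)
    exact indep_of_indep_of_le_left
      (indep_of_indep_of_le_right h (comap_le_generatedSigma L' t)) (comap_le_generatedSigma L s)
  have hXYS : IndepFun (fun ω => (L s ω, L' t ω)) (gridValues S) P := by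
    set 𝓕 : Fin 3 → MeasurableSpace Ω := ![generatedSigma S, generatedSigma L, generatedSigma L']
    have hle : ∀ i, 𝓕 i ≤ ‹MeasurableSpace Ω› := by
      intro i
      fin_cases i
      · exact generatedSigma_le hS.measurable
      · exact generatedSigma_le hL.1
      · exact generatedSigma_le hL'.1
    have h := indep_iSup_of_disjoint hle hindep (S := {1, 2}) (T := {0}) (by simp)
    have h0 : generatedSigma S ≤ ⨆ i ∈ ({0} : Set (Fin 3)), 𝓕 i :=
      le_iSup₂_of_le (0 : Fin 3) (by simp) le_rfl
    have h1 : generatedSigma L ≤ ⨆ i ∈ ({1, 2} : Set (Fin 3)), 𝓕 i :=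
      le_iSup₂_of_le (1 : Fin 3) (by simp) le_rfl
    have h2 : generatedSigma L' ≤ ⨆ i ∈ ({1, 2} : Set (Fin 3)), 𝓕 i :=
      le_iSup₂_of_le (2 : Fin 3) (by simp) le_rfl
    refine indep_of_indep_of_le_left (indep_of_indep_of_le_right h ?_) ?_
    · refine Measurable.comap_le (@measurable_gridValues _ _ (_) fun p => ?_)
      exact Measurable.of_comap_le ((comap_le_generatedSigma S p).trans h0)
    · refine Measurable.comap_le (@Measurable.prodMk _ _ _ _ _ (_) _ _ ?_ ?_)
      · exact Measurable.of_comap_le ((comap_le_generatedSigma L s).trans h1)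
      · exact Measurable.of_comap_le ((comap_le_generatedSigma L' t).trans h2)
  have hsum : ∀ N : ℕ, Summable (wrightTerm (upperParams N) (lowerParams α β N)
      (-(∑ j, lam₁ j + ∑ j, lam₂ j) * (s : ℝ) ^ α * (t : ℝ) ^ β)) := by
    intro N
    refine summable_wrightTerm hα hβ N ?_
    refine hconv.imp_right (Or.imp (fun h => ⟨h.1, ?_⟩) ?_)
    · rw [neg_mul, neg_mul, abs_neg, abs_of_nonneg (by positivity)]
      exact h.2
    · rintro (rfl | rfl)
      · simp [Real.zero_rpow hα.1.ne']
      · simp [Real.zero_rpow hβ.1.ne']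
  have hterm : ∀ (u : Fin k → ℤ) (m : Fin k → ℕ),
      ∫⁻ ω, ENNReal.ofReal (skellamCoeff lam₁ lam₂ u m *
        (((L s ω : ℝ) * L' t ω) ^ (∑ j, (2 * m j + (u j).natAbs)) *
          Real.exp (-(∑ j, lam₁ j + ∑ j, lam₂ j) * ((L s ω : ℝ) * L' t ω)))) ∂P =
      ENNReal.ofReal ((∏ j, (lam₁ j / lam₂ j) ^ ((u j : ℝ) / 2)) *
        skellamTerm lam₁ lam₂ α β s t u m) := by
    intro u m
    have hc := skellamCoeff_nonneg hr₁ hr₂ u m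
    simp_rw [ENNReal.ofReal_mul hc]
    rw [lintegral_const_mul _ (by fun_prop), lintegral_mul_pow_mul_exp hα.1 hβ.1 hL hL' hXY _
      (neg_nonpos.2 hΛ) (hsum _), ← ENNReal.ofReal_mul hc, skellamCoeff_mul_eq]
  have hpos : ∀ u : Fin k → ℤ, 0 < ∏ j, (lam₁ j / lam₂ j) ^ ((u j : ℝ) / 2) := fun u =>
    Finset.prod_pos fun j _ => Real.rpow_pos_of_pos (div_pos (hr₁ j) (hr₂ j)) _
  have hnonneg : ∀ (u : Fin k → ℤ) (m : Fin k → ℕ),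
      0 ≤ (∏ j, (lam₁ j / lam₂ j) ^ ((u j : ℝ) / 2)) * skellamTerm lam₁ lam₂ α β s t u m := by
    intro u m
    rw [← skellamCoeff_mul_eq]
    exact mul_nonneg (skellamCoeff_nonneg hr₁ hr₂ u m)
      (generalizedWright_nonneg hα.1 hβ.1 hL hL' hXY _ _ (hsum _))
  have hlaw : ∀ n : ℤ, P {ω | S (L s ω, L' t ω) ω = n} =
      ∑' (u : thetaInt k n) (m : Fin k → ℕ), ENNReal.ofReal
        ((∏ j, (lam₁ j / lam₂ j) ^ (((u : Fin k → ℤ) j : ℝ) / 2)) *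
          skellamTerm lam₁ lam₂ α β s t u m) := by
    intro n
    -- `thetaInt k n` is countable, so the one-point law is a measurable function of the point.
    rw [measure_random_evaluation hS.measurable hS.right_continuous hX hY hXYS n _
      (Measurable.tsum fun u => Measurable.tsum fun m => by fun_prop)
      fun p => hS.measure_eq_tsum p n]
    simp only
    rw [lintegral_tsum fun u => (Measurable.tsum fun m => by fun_prop).aemeasurable]
    refine tsum_congr fun u => ?_
    rw [lintegral_tsum fun m => by fun_prop]
    exact tsum_congr fun m => hterm u m
  have hsummable : ∀ u : Fin k → ℤ, Summable fun m =>
      (∏ j, (lam₁ j / lam₂ j) ^ ((u j : ℝ) / 2)) * skellamTerm lam₁ lam₂ α β s t u m := by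
    intro u
    -- Every `u` occurs in the law for its own weight `n = ∑ j u_j`, so its inner series is bounded
    -- by a probability.
    have hu : u ∈ thetaInt k (∑ j : Fin k, (((j : ℕ) : ℤ) + 1) * u j) := rfl
    have hle := ENNReal.le_tsum (f := fun u : thetaInt k (∑ j : Fin k, (((j : ℕ) : ℤ) + 1) * u j) =>
      ∑' m : Fin k → ℕ, ENNReal.ofReal
        ((∏ j, (lam₁ j / lam₂ j) ^ (((u : Fin k → ℤ) j : ℝ) / 2)) *
          skellamTerm lam₁ lam₂ α β s t u m)) ⟨u, hu⟩
    rw [← hlaw] at hle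
    exact (hasSum_of_tsum_ofReal_eq (hnonneg u) (ne_top_of_le_ne_top (measure_ne_top _ _) hle)
      rfl).summable
  refine ⟨aemeasurable_random_evaluation hS.measurable hS.right_continuous hX hY, hsum,
    fun u => (summable_mul_left_iff (hpos u).ne').1 (hsummable u), fun n => ?_⟩
  refine hasSum_of_tsum_ofReal_eq (fun u => ?_) (measure_ne_top P _) ?_
  · rw [← tsum_mul_left]
    exact tsum_nonneg (hnonneg u)
  · rw [hlaw]
    refine tsum_congr fun u => ?_
    rw [← tsum_mul_left]
    exact ENNReal.ofReal_tsum_of_nonneg (hnonneg u) (hsummable u)
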